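/- Let $\mathcal X=\mathbb N\times\mathbb N$, let $\Delta(\mathcal X)$ be the set of all probability distributions on $\mathcal X$, and let $d_{\mathrm{TV}}(p,q)=\sup_{B\subseteq\mathcal X}|p(B)-q(B)|$. A sample is a finite multiset of points of $\mathcal X$; $\mathcal X^*$ is the set of all samples, and $S\sim p^m$ means that $S$ is the multiset of $m$ independent draws from $p$. A learner is a function $A:\mathcal X^*\to\Delta(\mathcal X)$. Let $\mathcal C\subseteq\Delta(\mathcal X)$ and $\alpha\ge 1$. An oblivious adversary $V:\Delta(\mathcal X)\to\Delta(\mathcal X)$ is additive with budget $\eta\in[0,1]$ if for every $p$ there is $r\in\Delta(\mathcal X)$ with $V(p)=(1-\eta)p+\eta r$. The class $\mathcal C$ is obliviously additively $\alpha$-robustly learnable if there are a learner $A$ and a function $m_{\mathcal C}:(0,1)^2\to\mathbb N$ such that for all $p\in\mathcal C$, all $\eta\in[0,1]$, all oblivious additive adversaries $V$ with budget $\eta$, all $\epsilon,\delta\in(0,1)$ and all $m\ge m_{\mathcal C}(\epsilon,\delta)$, with probability at least $1-\delta$ over $S\sim V(p)^m$, $$d_{\mathrm{TV}}(A(S),p)\le\alpha\eta+\epsilon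 .$$ An adaptive adversary is a randomized map $V:\mathcal X^*\to\mathcal X^*$. It is additive if always $S\subseteq V(S)$ (as multisets). It has budget $\eta\in[0,1]$ if $|V(S)|$ depends only on $|S|$ and, for every $m\in\mathbb N$, $\eta m-1<m\cdot\mathrm{budget}(V,m)\le\eta m$, where $\mathrm{budget}(V,m)=\sup_{|S|=m}\frac{|V(S)|-|S|}{m}$ (so exactly $\lfloor\eta m\rfloor$ points are added to each sample of size $m\ge1$). The class $\mathcal C$ is adaptively additively $\alpha$-robustly learnable if there are a learner $A$ and a function $m_{\mathcal C}:(0,1)^2\to\mathbb N$ such that for all $p\in\mathcal C$, all $\eta\in[0,1]$, all adaptive additive adversaries $V$ with budget $\eta$, all $\epsilon,\delta\in(0,1)$ and all $m\ge m_{\mathcal C}(\epsilon,\delta)$, with probability at least $1-\delta$ over $S\sim p^m$ and the randomness of $V$, $$d_{\mathrm{TV}}(A(V(S)),p)\le\alpha\eta+\epsilon .$$ Corollary. There is a class $\mathcal C\subseteq\Delta(\mathcal X)$ that is obliviously additively $3$-robustly learnable but, for every real $\alpha\ge1$, is not adaptively additively $\alpha$-robustly learnable. -/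

import Mathlib

/-!
Distribution learning over a countable discrete domain `X`.  On such a domain every probability
distribution is determined by its point masses, so the set of all distributions is `PMF X`, and
likewise for distributions of samples, a sample being a finite multiset of points of `X`.
-/

namespace RobustLearning

/-- The probability of the event `E` under the distribution `P`. -/
noncomputable def prob {Ω : Type*} (P : PMF Ω) (E : Set Ω) : ℝ :=
  (P.toOuterMeasure E).toReal

/-- Total variation distance `sup_B |p(B) - q(B)|`. -/
noncomputable def tvDist {X : Type*} (p q : PMF X) : ℝ :=
  ⨆ B : Set X, |prob p B - prob q B|

/-- The law of the multiset of `m` independent draws from `p`. -/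
noncomputable def iidSample {X : Type*} (p : PMF X) : ℕ → PMF (Multiset X)
  | 0 => PMF.pure 0
  | m + 1 => p.bind fun x => (iidSample p m).map fun S => x ::ₘ S

/-- A learner maps each sample, of any size, to a distribution. -/
abbrev Learner (X : Type*) := Multiset X → PMF X

/-! ### Oblivious additive adversaries -/

/-- An oblivious adversary replaces the distribution that the sample is drawn from. -/
abbrev ObliviousAdversary (X : Type*) := PMF X → PMF X

/-- The oblivious adversary `V` is additive with fixed budget `η ∈ [0,1]`: for every `p` there is
a distribution `r` with `V p = (1 - η) p + η r`. -/
def ObliviousAdversary.IsAdditive {X : Type*} (V : ObliviousAdversary X) (η : ℝ) : Prop :=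
  0 ≤ η ∧ η ≤ 1 ∧
    ∀ p : PMF X, ∃ r : PMF X, ∀ x : X,
      (V p x).toReal = (1 - η) * (p x).toReal + η * (r x).toReal

/-- `C` is (obliviously) additively `α`-robustly learnable. -/
def ObliviouslyAdditivelyLearnable {X : Type*} (α : ℝ) (C : Set (PMF X)) : Prop :=
  ∃ (A : Learner X) (mC : ℝ → ℝ → ℕ),
    ∀ p ∈ C, ∀ (V : ObliviousAdversary X) (η : ℝ), V.IsAdditive η →
      ∀ ε ∈ Set.Ioo (0 : ℝ) 1, ∀ δ ∈ Set.Ioo (0 : ℝ) 1, ∀ m : ℕ, mC ε δ ≤ m →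
        1 - δ ≤ prob (iidSample (V p) m) {S | tvDist (A S) p ≤ α * η + ε}

/-! ### Adaptive additive adversaries -/

/-- A (randomized) adaptive adversary: `V S` is the law of the manipulated sample when the
drawn sample is `S`. -/
abbrev AdaptiveAdversary (X : Type*) := Multiset X → PMF (Multiset X)

/-- An additive adversary only adds points to the sample. -/
def AdaptiveAdversary.IsAdditive {X : Type*} (V : AdaptiveAdversary X) : Prop :=
  ∀ S : Multiset X, ∀ T ∈ (V S).support, S ≤ T

/-- `budget(V, m) = sup_{|S| = m} (|V(S)| - |S|) / m`. -/
noncomputable def AdaptiveAdversary.addBudget {X : Type*} (V : AdaptiveAdversary X) (m : ℕ) : ℝ :=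
  sSup {b : ℝ | ∃ S : Multiset X, S.card = m ∧ ∃ T ∈ (V S).support,
    b = ((T.card : ℝ) - (S.card : ℝ)) / (m : ℝ)}

/-- `V` has the fixed constant budget `η ∈ [0,1]`: the size of `V(S)` depends only on the size of
`S`, and `η m - 1 < m · budget(V, m) ≤ η m` for every `m`, that is, exactly `⌊η m⌋` points are
added to each sample of size `m ≥ 1`. -/
structure AdaptiveAdversary.HasBudget {X : Type*} (V : AdaptiveAdversary X) (η : ℝ) : Prop where
  nonneg : 0 ≤ η
  le_one : η ≤ 1
  card_eq : ∀ S₁ S₂ : Multiset X, S₁.card = S₂.card →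
    ∀ T₁ ∈ (V S₁).support, ∀ T₂ ∈ (V S₂).support, T₁.card = T₂.card
  lower : ∀ m : ℕ, η * m - 1 < m * V.addBudget m
  upper : ∀ m : ℕ, m * V.addBudget m ≤ η * m

/-- `C` is adaptively additively `α`-robustly learnable. The law of `V(S)` for `S ∼ p^m` is
`(iidSample p m).bind V`. -/
def AdaptivelyAdditivelyLearnable {X : Type*} (α : ℝ) (C : Set (PMF X)) : Prop :=
  ∃ (A : Learner X) (mC : ℝ → ℝ → ℕ),
    ∀ p ∈ C, ∀ (V : AdaptiveAdversary X) (η : ℝ), V.IsAdditive → V.HasBudget η →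
      ∀ ε ∈ Set.Ioo (0 : ℝ) 1, ∀ δ ∈ Set.Ioo (0 : ℝ) 1, ∀ m : ℕ, mC ε δ ≤ m →
        1 - δ ≤ prob ((iidSample p m).bind V) {T | tvDist (A T) p ≤ α * η + ε}

end RobustLearning

/-! A member of the class is given by a level `j`, a size `n` and a labelling `f` of `{0, …, n}`.
With `w = 1 / (j + 1)`, it puts mass `1 - w` on a common base point, mass `w ^ 2` on a mark that
reveals `(j, n, f)`, and spreads `w - w ^ 2` uniformly over the data points labelled by `f`. Without
the mark no sample size works for all `n` at once; with it one point identifies the member, but this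
information is fragile.

Oblivious learning. For `η ≤ 1 / 3` contamination leaves at least two thirds of the mass of the
mark, so the true mark occurs in a large sample, among finitely many possibly false ones. The
learner chooses, among the candidates marked in the sample and the point mass at the base, one whose
masses of the base and of its own region exceed the empirical frequencies least. Additive
contamination lowers the probability of an event by at most `η`, so the truth has deficit about `η`.
Conversely, members agree where their regions meet, so a candidate of small deficit is within `3 *
η` plus a small error of the truth (`tvDist_candLaw_le_of_fit`). The candidate regions depend on the
sample; `exists_prob_exists_hits_le` controls them by a union bound over sample points, which costs
nothing in `n`. For `η > 1 / 3` the claim is trivial.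

Adaptive impossibility. Seeing the sample, the adversary flips `f` at all unseen data points and
adds as many marks of the flipped labelling as there are true marks. The outcome is the same for `f`
and for its flip (`maskedSample_symmDiff`), while with `n = 2 * m` the two members are at distance
at least `w / 2` (`half_levelWeight_le`). Hence, averaged over `f`, the learner has error below `w /
4` with probability little above `1 / 2`. The budget needed is only `2 * w ^ 2`, and `α * (2 * w ^
2)` is negligible against `w` at a high level, whatever `α` is. -/

namespace RobustLearning

open scoped ENNReal

/-! ### Expectations under discrete distributions -/

section Expectation

variable {Ω Ω' X : Type*}

/-- The expectation of a nonnegative function under a discrete distribution. -/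
noncomputable def expect (P : PMF Ω) (g : Ω → ℝ≥0∞) : ℝ≥0∞ :=
  ∑' ω, P ω * g ω

theorem expect_pure (a : Ω) (g : Ω → ℝ≥0∞) : expect (PMF.pure a) g = g a := by
  classical
  rw [expect, tsum_eq_single a]
  · simp
  · intro b hb
    simp [hb]

theorem expect_bind (P : PMF Ω) (k : Ω → PMF Ω') (g : Ω' → ℝ≥0∞) :
    expect (P.bind k) g = expect P fun ω => expect (k ω) g := by
  simp only [expect, PMF.bind_apply, ← ENNReal.tsum_mul_right, ← ENNReal.tsum_mul_left]
  rw [ENNReal.tsum_comm]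
  simp only [mul_assoc]

theorem expect_map (P : PMF Ω) (e : Ω → Ω') (g : Ω' → ℝ≥0∞) :
    expect (P.map e) g = expect P fun ω => g (e ω) := by
  rw [PMF.map, expect_bind]
  simp only [Function.comp, expect_pure]

theorem expect_comm (P : PMF Ω) (Q : PMF Ω') (F : Ω → Ω' → ℝ≥0∞) :
    (expect P fun ω => expect Q (F ω)) = expect Q fun ω' => expect P fun ω => F ω ω' := by
  simp only [expect, ← ENNReal.tsum_mul_left]
  rw [ENNReal.tsum_comm]
  simp only [mul_left_comm]

theorem expect_mono (P : PMF Ω) {g g' : Ω → ℝ≥0∞} (h : ∀ ω, g ω ≤ g' ω) :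
    expect P g ≤ expect P g' :=
  ENNReal.tsum_le_tsum fun ω => by gcongr; exact h ω

theorem expect_add (P : PMF Ω) (g g' : Ω → ℝ≥0∞) :
    (expect P fun ω => g ω + g' ω) = expect P g + expect P g' := by
  simp only [expect, mul_add, ENNReal.tsum_add]

theorem expect_const_mul (P : PMF Ω) (c : ℝ≥0∞) (g : Ω → ℝ≥0∞) :
    (expect P fun ω => c * g ω) = c * expect P g := by
  simp only [expect, ← ENNReal.tsum_mul_left, mul_left_comm]

theorem expect_const (P : PMF Ω) (c : ℝ≥0∞) : (expect P fun _ => c) = c := by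
  simp [expect, ENNReal.tsum_mul_right, P.tsum_coe]

theorem expect_finset_sum {ι : Type*} (P : PMF Ω) (s : Finset ι) (g : ι → Ω → ℝ≥0∞) :
    (expect P fun ω => ∑ i ∈ s, g i ω) = ∑ i ∈ s, expect P (g i) := by
  simp only [expect, Finset.mul_sum]
  exact Summable.tsum_finsetSum fun _ _ => ENNReal.summable

theorem toOuterMeasure_eq_expect (P : PMF Ω) (E : Set Ω) :
    P.toOuterMeasure E = expect P (E.indicator 1) := by
  rw [PMF.toOuterMeasure_apply, expect]
  refine tsum_congr fun ω => ?_
  by_cases h : ω ∈ E <;> simp [h]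

theorem toOuterMeasure_univ (P : PMF Ω) : P.toOuterMeasure Set.univ = 1 := by
  simp [PMF.toOuterMeasure_apply, P.tsum_coe]

theorem toOuterMeasure_le_one (P : PMF Ω) (E : Set Ω) : P.toOuterMeasure E ≤ 1 :=
  (toOuterMeasure_univ P) ▸ P.toOuterMeasure.mono (Set.subset_univ E)

theorem toOuterMeasure_ne_top (P : PMF Ω) (E : Set Ω) : P.toOuterMeasure E ≠ ⊤ :=
  ne_top_of_le_ne_top ENNReal.one_ne_top (toOuterMeasure_le_one P E)

theorem ofReal_prob (P : PMF Ω) (E : Set Ω) : ENNReal.ofReal (prob P E) = P.toOuterMeasure E :=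
  ENNReal.ofReal_toReal (toOuterMeasure_ne_top P E)

theorem prob_nonneg (P : PMF Ω) (E : Set Ω) : 0 ≤ prob P E := ENNReal.toReal_nonneg

theorem prob_mono (P : PMF Ω) {E F : Set Ω} (h : E ⊆ F) : prob P E ≤ prob P F :=
  ENNReal.toReal_mono (toOuterMeasure_ne_top P F) (P.toOuterMeasure.mono h)

theorem prob_univ (P : PMF Ω) : prob P Set.univ = 1 := by
  rw [prob, toOuterMeasure_univ, ENNReal.toReal_one]

theorem prob_empty (P : PMF Ω) : prob P ∅ = 0 := by simp [prob]

theorem prob_le_one (P : PMF Ω) (E : Set Ω) : prob P E ≤ 1 :=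
  prob_univ P ▸ prob_mono P (Set.subset_univ E)

theorem prob_union_le (P : PMF Ω) (E F : Set Ω) : prob P (E ∪ F) ≤ prob P E + prob P F := by
  rw [prob, prob, prob, ← ENNReal.toReal_add (toOuterMeasure_ne_top P E)
    (toOuterMeasure_ne_top P F)]
  exact ENNReal.toReal_mono (ENNReal.add_ne_top.2 ⟨toOuterMeasure_ne_top P E,
    toOuterMeasure_ne_top P F⟩) (MeasureTheory.measure_union_le E F)

theorem prob_union (P : PMF Ω) {E F : Set Ω} (h : Disjoint E F) :
    prob P (E ∪ F) = prob P E + prob P F := by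
  rw [prob, prob, prob, ← ENNReal.toReal_add (toOuterMeasure_ne_top P E)
    (toOuterMeasure_ne_top P F)]
  congr 1
  rw [toOuterMeasure_eq_expect, toOuterMeasure_eq_expect, toOuterMeasure_eq_expect,
    ← expect_add, Set.indicator_union_of_disjoint h]

theorem prob_compl (P : PMF Ω) (E : Set Ω) : prob P Eᶜ = 1 - prob P E := by
  have := prob_union P (disjoint_compl_right (a := E))
  rw [Set.union_compl_self, prob_univ] at this
  linarith

theorem prob_singleton (P : PMF Ω) (a : Ω) : prob P {a} = (P a).toReal := by
  rw [prob, PMF.toOuterMeasure_apply_singleton]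

theorem prob_map (P : PMF Ω) (e : Ω → Ω') (E : Set Ω') :
    prob (P.map e) E = prob P (e ⁻¹' E) := by
  rw [prob, prob, PMF.toOuterMeasure_map_apply]

/-- If `c · p ≤ q` pointwise on `E` then `c · p(E) ≤ q(E)`. -/
theorem mul_prob_le {p q : PMF Ω} {c : ℝ} (hc : 0 ≤ c) {E : Set Ω}
    (h : ∀ x ∈ E, c * (p x).toReal ≤ (q x).toReal) : c * prob p E ≤ prob q E := by
  have key : ENNReal.ofReal c * p.toOuterMeasure E ≤ q.toOuterMeasure E := by
    rw [PMF.toOuterMeasure_apply, PMF.toOuterMeasure_apply, ← ENNReal.tsum_mul_left]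
    refine ENNReal.tsum_le_tsum fun x => ?_
    by_cases hx : x ∈ E
    · rw [Set.indicator_of_mem hx, Set.indicator_of_mem hx,
        ← ENNReal.ofReal_toReal (p.apply_ne_top x), ← ENNReal.ofReal_toReal (q.apply_ne_top x),
        ← ENNReal.ofReal_mul hc]
      exact ENNReal.ofReal_le_ofReal (h x hx)
    · simp [hx]
  have := ENNReal.toReal_mono (toOuterMeasure_ne_top q E) key
  rwa [ENNReal.toReal_mul, ENNReal.toReal_ofReal hc] at this

theorem tvDist_le {p q : PMF Ω} {c : ℝ} (h : ∀ B : Set Ω, prob p B - prob q B ≤ c) :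
    tvDist p q ≤ c := by
  refine ciSup_le fun B => abs_le'.2 ⟨h B, ?_⟩
  have := h Bᶜ
  rw [prob_compl, prob_compl] at this
  linarith

theorem abs_prob_sub_le_tvDist (p q : PMF Ω) (B : Set Ω) :
    |prob p B - prob q B| ≤ tvDist p q := by
  refine le_ciSup (f := fun B : Set Ω => |prob p B - prob q B|) ⟨1, ?_⟩ B
  rintro _ ⟨B, rfl⟩
  refine abs_le.2 ⟨?_, ?_⟩ <;>
    linarith [prob_nonneg p B, prob_nonneg q B, prob_le_one p B, prob_le_one q B]

theorem tvDist_comm (p q : PMF Ω) : tvDist p q = tvDist q p := by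
  simp only [tvDist, abs_sub_comm]

theorem tvDist_le_one (p q : PMF Ω) : tvDist p q ≤ 1 :=
  tvDist_le fun B => by linarith [prob_le_one p B, prob_nonneg q B]

end Expectation

/-! ### Concentration for samples -/

section Concentration

variable {X Y : Type*}

theorem iidSample_card (p : PMF X) (m : ℕ) : ∀ S ∈ (iidSample p m).support, S.card = m := by
  induction m with
  | zero => simp [iidSample]
  | succ m ih =>
    intro S hS
    simp only [iidSample, PMF.mem_support_bind_iff, PMF.mem_support_map_iff] at hS
    obtain ⟨x, -, S', hS', rfl⟩ := hS
    simp [ih S' hS']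

theorem iidSample_map (p : PMF X) (e : X → Y) (m : ℕ) :
    iidSample (p.map e) m = (iidSample p m).map (Multiset.map e) := by
  induction m with
  | zero => simp [iidSample, PMF.pure_map]
  | succ m ih =>
    simp only [iidSample, ih, PMF.bind_map, PMF.map_bind, PMF.map_comp]
    congr 1
    funext x
    simp only [Function.comp_def, Multiset.map_cons]

theorem expect_iidSample_succ (p : PMF X) (m : ℕ) (g : Multiset X → ℝ≥0∞) :
    expect (iidSample p (m + 1)) g =
      expect p fun x => expect (iidSample p m) fun S => g (x ::ₘ S) := by
  simp only [iidSample, expect_bind, expect_map]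

theorem expect_iidSample_prod (p : PMF X) (g : X → ℝ≥0∞) (m : ℕ) :
    (expect (iidSample p m) fun S => (S.map g).prod) = expect p g ^ m := by
  induction m with
  | zero => simp [iidSample, expect_pure]
  | succ m ih =>
    rw [expect_iidSample_succ]
    simp only [Multiset.map_cons, Multiset.prod_cons, expect_const_mul, ih]
    simp only [mul_comm _ (expect p g ^ m), expect_const_mul, pow_succ]

/-- The expected sum, over the points of a sample, of a function of the point and the sample. -/
theorem expect_iidSample_sum (p : PMF X) (m : ℕ) (F : X → Multiset X → ℝ≥0∞) :
    (expect (iidSample p (m + 1)) fun S => (S.map fun x => F x S).sum) =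
      (m + 1) * expect p fun x => expect (iidSample p m) fun S => F x (x ::ₘ S) := by
  induction m generalizing F with
  | zero =>
    rw [expect_iidSample_succ]
    simp [iidSample, expect_pure]
  | succ m ih =>
    rw [expect_iidSample_succ]
    simp only [Multiset.map_cons, Multiset.sum_cons, expect_add]
    -- The first draw `x` is frozen inside the summand; this is why the induction is over all `F`.
    have h : ∀ x, (expect (iidSample p (m + 1)) fun S => (S.map fun y => F y (x ::ₘ S)).sum) =
        (m + 1) * expect p fun y => expect (iidSample p m) fun S => F y (x ::ₘ y ::ₘ S) :=
      fun x => ih fun y S => F y (x ::ₘ S)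
    simp only [h, expect_const_mul]
    rw [expect_comm p p]
    have h' : ∀ y, (expect p fun x => expect (iidSample p m) fun S => F y (x ::ₘ y ::ₘ S)) =
        expect (iidSample p (m + 1)) fun S => F y (y ::ₘ S) := by
      intro y
      rw [expect_iidSample_succ]
      exact congrArg _ (funext fun x => congrArg _ (funext fun S => by rw [Multiset.cons_swap]))
    simp only [h']
    push_cast
    ring

open Classical in
/-- The number of points of the sample `S` that lie in `E`. -/
noncomputable def hits (E : Set X) (S : Multiset X) : ℕ := S.countP (· ∈ E)

theorem hits_cons_le (E : Set X) (x : X) (S : Multiset X) : hits E (x ::ₘ S) ≤ hits E S + 1 := by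
  classical
  unfold hits
  rw [Multiset.countP_cons]
  split_ifs <;> omega

theorem hits_add_hits_compl (E : Set X) (S : Multiset X) : hits E S + hits Eᶜ S = S.card := by
  classical
  unfold hits
  rw [Multiset.card_eq_countP_add_countP (· ∈ E) S]
  congr!

/-- The product form lets `expect_iidSample_prod` evaluate the moment generating function of the hit
count. -/
theorem prod_exp_indicator (E : Set X) {l : ℝ} (hl : 0 ≤ l) (S : Multiset X) :
    (S.map fun x => 1 + E.indicator (fun _ => ENNReal.ofReal (Real.exp l - 1)) x).prod =
      ENNReal.ofReal (Real.exp (l * hits E S)) := by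
  classical
  have h0 : 0 ≤ Real.exp l - 1 := by linarith [Real.add_one_le_exp l]
  induction S using Multiset.induction_on with
  | empty => simp [hits]
  | cons x S ih =>
    rw [Multiset.map_cons, Multiset.prod_cons, ih]
    unfold hits
    rw [Multiset.countP_cons]
    by_cases hx : x ∈ E
    · rw [Set.indicator_of_mem hx, if_pos hx, ← ENNReal.ofReal_one,
        ← ENNReal.ofReal_add zero_le_one h0, ← ENNReal.ofReal_mul (by linarith)]
      push_cast
      rw [mul_add, Real.exp_add]
      congr 1
      ring_nf
    · simp [hx]

/-- Chernoff's bound for the number of sample points in a fixed event. -/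
theorem toOuterMeasure_hits_le (p : PMF X) (E : Set X) (m : ℕ) {t : ℝ} (ht : 0 < t)
    (ht1 : t ≤ 1) :
    (iidSample p m).toOuterMeasure {S | m * (prob p E + t) < hits E S} ≤
      ENNReal.ofReal (Real.exp (-(m * t ^ 2 / 4))) := by
  -- Since `exp l - 1 ≤ l + l ^ 2`, the exponent is at most `m * (l ^ 2 - l * t)`, which is least at
  -- `l = t / 2`.
  set l := t / 2 with hl
  have hl0 : 0 ≤ l := by positivity
  have he : Real.exp l - 1 ≤ l + l ^ 2 := by
    have := (abs_le.1 (Real.abs_exp_sub_one_sub_id_le (x := l)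
      (abs_le.2 ⟨by linarith, by linarith⟩))).2
    linarith
  have he0 : 0 ≤ Real.exp l - 1 := by linarith [Real.add_one_le_exp l]
  have hmgf : expect p (fun x => 1 + E.indicator (fun _ => ENNReal.ofReal (Real.exp l - 1)) x) ≤
      ENNReal.ofReal (Real.exp (prob p E * (l + l ^ 2))) := by
    have h1 : expect p (E.indicator fun _ => ENNReal.ofReal (Real.exp l - 1)) =
        ENNReal.ofReal ((Real.exp l - 1) * prob p E) := by
      rw [ENNReal.ofReal_mul he0, ofReal_prob, toOuterMeasure_eq_expect, ← expect_const_mul]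
      congr 1
      funext x
      by_cases hx : x ∈ E <;> simp [hx]
    rw [expect_add, expect_const, h1, ← ENNReal.ofReal_one,
      ← ENNReal.ofReal_add zero_le_one (mul_nonneg he0 (prob_nonneg p E))]
    refine ENNReal.ofReal_le_ofReal ?_
    refine le_trans ?_ (Real.add_one_le_exp _)
    nlinarith [prob_nonneg p E]
  -- The pointwise form of Markov's inequality for the exponential moment.
  have hmark : ∀ S : Multiset X,
      ({S | m * (prob p E + t) < hits E S} : Set (Multiset X)).indicator 1 S ≤
        ENNReal.ofReal (Real.exp (-(l * (m * (prob p E + t))))) *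
          (S.map fun x => 1 + E.indicator (fun _ => ENNReal.ofReal (Real.exp l - 1)) x).prod := by
    intro S
    rw [prod_exp_indicator E hl0 S,
      ← ENNReal.ofReal_mul (Real.exp_nonneg _), ← Real.exp_add]
    refine Set.indicator_apply_le' (fun hS => ?_) fun _ => zero_le
    rw [Pi.one_apply, ← ENNReal.ofReal_one]
    refine ENNReal.ofReal_le_ofReal (Real.one_le_exp ?_)
    have : l * (m * (prob p E + t)) ≤ l * hits E S := mul_le_mul_of_nonneg_left (le_of_lt hS) hl0
    linarith
  rw [toOuterMeasure_eq_expect]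
  refine (expect_mono _ hmark).trans ?_
  rw [expect_const_mul, expect_iidSample_prod]
  calc _ ≤ ENNReal.ofReal (Real.exp (-(l * (m * (prob p E + t))))) *
        ENNReal.ofReal (Real.exp (prob p E * (l + l ^ 2))) ^ m := by gcongr
    _ = ENNReal.ofReal (Real.exp (-(l * (m * (prob p E + t))) +
          m * (prob p E * (l + l ^ 2)))) := by
        rw [← ENNReal.ofReal_pow (Real.exp_nonneg _), ← Real.exp_nat_mul,
          ← ENNReal.ofReal_mul (Real.exp_nonneg _), ← Real.exp_add]
    _ ≤ _ := by
        refine ENNReal.ofReal_le_ofReal (Real.exp_le_exp.2 ?_)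
        have h1 : prob p E * l ^ 2 ≤ l ^ 2 :=
          mul_le_of_le_one_left (sq_nonneg l) (prob_le_one p E)
        have h2 : (m : ℝ) * (prob p E * l ^ 2) ≤ m * l ^ 2 :=
          mul_le_mul_of_nonneg_left h1 (Nat.cast_nonneg m)
        rw [hl] at h2 ⊢
        nlinarith

/-- The factor `m + 1` pays for the union bound over the points of a sample. -/
theorem tendsto_nat_mul_exp_neg {c : ℝ} (hc : 0 < c) :
    Filter.Tendsto (fun m : ℕ => ((m : ℝ) + 1) * Real.exp (-(m * c))) Filter.atTop (nhds 0) := by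
  have h1 := (Real.tendsto_pow_mul_exp_neg_atTop_nhds_zero 1).comp
    (Filter.Tendsto.atTop_mul_const hc tendsto_natCast_atTop_atTop)
  have h0 := (Real.tendsto_pow_mul_exp_neg_atTop_nhds_zero 0).comp
    (Filter.Tendsto.atTop_mul_const hc tendsto_natCast_atTop_atTop)
  have := (h1.mul_const c⁻¹).add h0
  simp only [zero_mul, add_zero] at this
  refine this.congr fun m => ?_
  simp only [Function.comp, pow_one, pow_zero, one_mul]
  field_simp

/-- Uniformly over distributions and events, the relative frequency of a fixed event in a large
sample rarely exceeds its probability by `t`. -/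
theorem exists_prob_hits_le {t δ : ℝ} (ht : 0 < t) (hδ : 0 < δ) :
    ∃ M : ℕ, ∀ m, M ≤ m → ∀ (p : PMF X) (E : Set X),
      prob (iidSample p m) {S | m * (prob p E + t) < hits E S} ≤ δ := by
  wlog ht1 : t ≤ 1 generalizing t
  · obtain ⟨M, hM⟩ := this one_pos le_rfl
    refine ⟨M, fun m hm p E => (prob_mono _ fun S hS => ?_).trans (hM m hm p E)⟩
    rw [Set.mem_ofPred_eq] at hS ⊢
    refine lt_of_le_of_lt ?_ hS
    gcongr
    exact (not_le.1 ht1).le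
  obtain ⟨M, hM⟩ := Filter.eventually_atTop.1 ((tendsto_nat_mul_exp_neg
    (show 0 < t ^ 2 / 4 by positivity)).eventually (gt_mem_nhds hδ))
  refine ⟨M, fun m hm p E => ?_⟩
  have h := ENNReal.toReal_mono ENNReal.ofReal_ne_top (toOuterMeasure_hits_le p E m ht ht1)
  rw [ENNReal.toReal_ofReal (Real.exp_nonneg _)] at h
  refine h.trans (le_trans ?_ (hM m hm).le)
  rw [mul_div_assoc]
  exact le_mul_of_one_le_left (Real.exp_nonneg _) (by simp)

/-- The frequencies of the events attached to the sample points themselves rarely exceed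
their probabilities by `t`. -/
theorem exists_prob_exists_hits_le {t δ : ℝ} (ht : 0 < t) (hδ : 0 < δ) :
    ∃ M : ℕ, ∀ m, M ≤ m → ∀ (p : PMF X) (F : X → Set X),
      prob (iidSample p m) {S | ∃ x ∈ S, m * (prob p (F x) + t) < hits (F x) S} ≤ δ := by
  wlog ht1 : t ≤ 1 generalizing t
  · obtain ⟨M, hM⟩ := this one_pos le_rfl
    refine ⟨M, fun m hm p F => (prob_mono _ ?_).trans (hM m hm p F)⟩
    rintro S ⟨x, hx, hS⟩
    refine ⟨x, hx, ?_⟩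
    refine lt_of_le_of_lt ?_ hS
    gcongr
    exact (not_le.1 ht1).le
  obtain ⟨M, hM⟩ := Filter.eventually_atTop.1 ((tendsto_nat_mul_exp_neg
    (show 0 < (t / 2) ^ 2 / 4 by positivity)).eventually (gt_mem_nhds hδ))
  -- A sample point may be a hit of its own event. Once `m * (t / 2) ≥ 1`, this one extra hit is
  -- absorbed by replacing `t` with `t / 2`.
  obtain ⟨N, hN⟩ := exists_nat_gt (2 / t)
  refine ⟨max M N + 1, fun m hm p F => ?_⟩
  obtain ⟨m, rfl⟩ : ∃ k, m = k + 1 := ⟨m - 1, by omega⟩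
  have hmN : 1 ≤ (m : ℝ) * (t / 2) := by
    have h1 : (N : ℝ) ≤ m := by exact_mod_cast (by omega : N ≤ m)
    have h2 : 2 / t ≤ m := by linarith
    rw [div_le_iff₀ ht] at h2
    linarith
  have hb : (iidSample p (m + 1)).toOuterMeasure
      {S | ∃ x ∈ S, ((m + 1 : ℕ) : ℝ) * (prob p (F x) + t) < hits (F x) S} ≤
        ENNReal.ofReal ((m + 1) * Real.exp (-(m * ((t / 2) ^ 2 / 4)))) := by
    let G : X → Multiset X → ℝ≥0∞ := fun x =>
      ({S | ((m + 1 : ℕ) : ℝ) * (prob p (F x) + t) < hits (F x) S} : Set _).indicator 1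
    have h1 : ∀ S : Multiset X,
        ({S | ∃ x ∈ S, ((m + 1 : ℕ) : ℝ) * (prob p (F x) + t) < hits (F x) S} :
          Set (Multiset X)).indicator 1 S ≤ (S.map fun x => G x S).sum := by
      intro S
      refine Set.indicator_apply_le' (fun ⟨x, hx, hS⟩ => ?_) fun _ => zero_le
      refine le_trans (le_of_eq ?_) (Multiset.single_le_sum (fun _ _ => zero_le) (G x S)
        (Multiset.mem_map_of_mem _ hx))
      exact (Set.indicator_of_mem hS 1).symm
    rw [toOuterMeasure_eq_expect]
    refine (expect_mono _ h1).trans ?_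
    rw [expect_iidSample_sum]
    -- Once the singled-out point `x` is fixed, its event is fixed too and the other `m` draws are
    -- independent of it, so Chernoff's bound applies.
    have h2 : ∀ x, (expect (iidSample p m) fun S => G x (x ::ₘ S)) ≤
        ENNReal.ofReal (Real.exp (-(m * ((t / 2) ^ 2 / 4)))) := by
      intro x
      rw [← mul_div_assoc]
      refine le_trans ?_ (toOuterMeasure_hits_le p (F x) m (half_pos ht) (by linarith))
      rw [toOuterMeasure_eq_expect]
      refine expect_mono _ fun S => Set.indicator_apply_le' (fun hS => ?_) fun _ => zero_le
      rw [Set.indicator_of_mem, Pi.one_apply, Pi.one_apply]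
      have h3 : ((hits (F x) (x ::ₘ S) : ℕ) : ℝ) ≤ hits (F x) S + 1 := by
        exact_mod_cast hits_cons_le (F x) x S
      simp only [Set.mem_ofPred_eq] at hS ⊢
      push_cast at hS
      have := prob_nonneg p (F x)
      nlinarith
    calc _ ≤ ((m : ℝ≥0∞) + 1) * expect p fun _ =>
          ENNReal.ofReal (Real.exp (-(m * ((t / 2) ^ 2 / 4)))) := by
          gcongr
          exact expect_mono _ h2
      _ = _ := by
          rw [expect_const, ENNReal.ofReal_mul (by positivity)]
          congr 1
          rw [ENNReal.ofReal_add (by positivity) zero_le_one]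
          simp
  have h := ENNReal.toReal_mono ENNReal.ofReal_ne_top hb
  rw [ENNReal.toReal_ofReal (by positivity)] at h
  exact h.trans (hM m (by omega)).le

end Concentration

/-! ### Families of distributions whose members are identified by a mark -/

/-- A family of distributions `law i`, each putting mass `1 - weight i` on a common base point and
the rest on `region i`.  Two members agree on the intersection of their regions, and a point
`mark i`, whose mass is bounded below in terms of `weight i`, identifies the index. -/
structure MarkedFamily (I X : Type*) where
  base : X
  law : I → PMF X
  weight : I → ℝ
  region : I → Set X
  mark : I → X
  mark_injective : Function.Injective mark
  base_notMem : ∀ i, base ∉ region i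
  prob_base : ∀ i, prob (law i) {base} = 1 - weight i
  prob_region : ∀ i, prob (law i) (region i) = weight i
  law_le : ∀ i j, ∀ x ∈ region i, x ∈ region j → law i x ≤ law j x
  exists_le_prob_mark : ∀ ε : ℝ, 0 < ε → ∃ c : ℝ, 0 < c ∧
    ∀ i, ε ≤ weight i → c ≤ prob (law i) {mark i}

namespace MarkedFamily

variable {I X : Type*} (F : MarkedFamily I X)

/-- The candidate distributions: the members of the family and the point mass at the base. -/
noncomputable def candLaw : Option I → PMF X
  | none => PMF.pure F.base
  | some i => F.law i

/-- The mass of a candidate away from the base. -/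
def candWeight : Option I → ℝ
  | none => 0
  | some i => F.weight i

/-- The region of a candidate. -/
def candRegion : Option I → Set X
  | none => ∅
  | some i => F.region i

theorem base_notMem_candRegion : ∀ h, F.base ∉ F.candRegion h
  | none => Set.notMem_empty _
  | some i => F.base_notMem i

theorem prob_candLaw_base : ∀ h, prob (F.candLaw h) {F.base} = 1 - F.candWeight h
  | none => by simp [candLaw, candWeight, prob_singleton]
  | some i => F.prob_base i

theorem law_le_candLaw (i : I) : ∀ h, ∀ x ∈ F.region i, x ∈ F.candRegion h →
    F.law i x ≤ F.candLaw h x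
  | none, _, _, hx => absurd hx (Set.notMem_empty _)
  | some j, x, hx, hx' => F.law_le i j x hx hx'

/-- The true law lives on the base and its region. Where the two regions meet the candidate has at
least as much mass, so an event can lose only the part of the region outside the candidate's and the
surplus at the base. -/
theorem tvDist_candLaw_le (i : I) (h : Option I) :
    tvDist (F.candLaw h) (F.law i) ≤
      prob (F.law i) (F.region i \ F.candRegion h) + max 0 (F.candWeight h - F.weight i) := by
  rw [tvDist_comm]
  refine tvDist_le fun B => ?_
  set p := F.law i
  set p' := F.candLaw h
  set A := F.region i
  set A' := F.candRegion h
  have hrest : prob p (B \ ({F.base} ∪ A)) = 0 := by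
    have h1 : prob p ({F.base} ∪ A) = 1 := by
      rw [prob_union p (Set.disjoint_singleton_left.2 (F.base_notMem i)), F.prob_base,
        F.prob_region]
      ring
    refine le_antisymm ?_ (prob_nonneg _ _)
    calc _ ≤ prob p ({F.base} ∪ A)ᶜ := prob_mono p fun x hx => hx.2
      _ = 0 := by rw [prob_compl, h1, sub_self]
  have hB : prob p B ≤ prob p (B ∩ {F.base}) + prob p (B ∩ (A ∩ A')) + prob p (A \ A') := by
    have hsub : B ⊆ ((B ∩ {F.base} ∪ B ∩ (A ∩ A')) ∪ A \ A') ∪ B \ ({F.base} ∪ A) := by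
      intro x hx
      by_cases h1 : x = F.base <;> by_cases h2 : x ∈ A <;> by_cases h3 : x ∈ A' <;>
        simp_all
    have := prob_mono p hsub
    have h1 := prob_union_le p ((B ∩ {F.base} ∪ B ∩ (A ∩ A')) ∪ A \ A') (B \ ({F.base} ∪ A))
    have h2 := prob_union_le p (B ∩ {F.base} ∪ B ∩ (A ∩ A')) (A \ A')
    have h3 := prob_union_le p (B ∩ {F.base}) (B ∩ (A ∩ A'))
    linarith
  have hB' : prob p' (B ∩ {F.base}) + prob p' (B ∩ (A ∩ A')) ≤ prob p' B := by
    rw [← prob_union p']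
    · exact prob_mono p' (by simp)
    · refine Set.disjoint_left.2 ?_
      rintro x ⟨-, rfl⟩ ⟨-, hx, -⟩
      exact F.base_notMem i hx
  have hAA : prob p (B ∩ (A ∩ A')) ≤ prob p' (B ∩ (A ∩ A')) := by
    have := mul_prob_le (p := p) (q := p') zero_le_one (E := B ∩ (A ∩ A')) fun x hx => by
      rw [one_mul]
      exact ENNReal.toReal_mono (p'.apply_ne_top x) (F.law_le_candLaw i h x hx.2.1 hx.2.2)
    rwa [one_mul] at this
  have hbase : prob p (B ∩ {F.base}) - prob p' (B ∩ {F.base}) ≤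
      max 0 (F.candWeight h - F.weight i) := by
    by_cases hb : F.base ∈ B
    · rw [Set.inter_eq_right.2 (Set.singleton_subset_iff.2 hb), F.prob_base, F.prob_candLaw_base]
      exact le_max_of_le_right (by linarith)
    · rw [Set.inter_singleton_eq_empty.2 hb, prob_empty, prob_empty, sub_self]
      exact le_max_left _ _
  linarith

/-- A candidate which fits a contamination of `law i` almost as well as `law i` is close to it. -/
theorem tvDist_candLaw_le_of_fit (i : I) (h : Option I) {q : PMF X} {η e : ℝ} (hη : 0 ≤ η)
    (hη' : η ≤ 1 / 3) (he : 0 ≤ e) (hq : ∀ E, (1 - η) * prob (F.law i) E ≤ prob q E)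
    (hbase : 1 - F.candWeight h - prob q {F.base} ≤ η + e)
    (hregion : F.candWeight h - prob q (F.candRegion h) ≤ η + e) :
    tvDist (F.candLaw h) (F.law i) ≤ 3 * η + 3 * e := by
  have htv := F.tvDist_candLaw_le i h
  set T := prob (F.law i) (F.region i \ F.candRegion h)
  -- Three disjoint events: a candidate that fits the first two leaves little `q`-mass for the
  -- third, where the true law could escape it.
  have hsum : prob q {F.base} + prob q (F.candRegion h) +
      prob q (F.region i \ F.candRegion h) ≤ 1 := by
    rw [← prob_union q (Set.disjoint_singleton_left.2 (F.base_notMem_candRegion h)),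
      ← prob_union q]
    · exact prob_le_one _ _
    · refine Set.disjoint_left.2 ?_
      rintro x (rfl | hx) ⟨h1, h2⟩
      · exact F.base_notMem i h1
      · exact h2 hx
  have hT := hq (F.region i \ F.candRegion h)
  have hb := hq {F.base}
  rw [F.prob_base] at hb
  have hT0 : 0 ≤ T := prob_nonneg _ _
  have hw : 0 ≤ F.weight i := F.prob_region i ▸ prob_nonneg _ _
  -- If the candidate is lighter, both fit conditions give `(1 - η) * T ≤ 2 * η + 2 * e`. If it is
  -- heavier, the bound on `q` at the base comes from the true law and pays for the weight
  -- difference. Dividing by `1 - η ≥ 2 / 3` costs a factor of at most `3 / 2`.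
  rcases le_total (F.candWeight h) (F.weight i) with hle | hle
  · rw [max_eq_left (by linarith)] at htv
    nlinarith
  · rw [max_eq_right (by linarith)] at htv
    nlinarith [mul_nonneg hη hw]

/-! ### The learner and its guarantee. -/

/-- The amount by which a candidate exceeds the empirical frequencies. -/
noncomputable def deficit (S : Multiset X) (h : Option I) : ℝ :=
  max (1 - F.candWeight h - hits {F.base} S / S.card)
    (F.candWeight h - hits (F.candRegion h) S / S.card)

/-- The candidates whose mark is in the sample, and the point mass at the base. -/
def cands (S : Multiset X) : Set (Option I) := {h | ∀ i, h = some i → F.mark i ∈ S}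

theorem finite_cands (S : Multiset X) : (F.cands S).Finite := by
  classical
  have h1 : {i | F.mark i ∈ S}.Finite :=
    (S.toFinset.finite_toSet.preimage F.mark_injective.injOn).subset fun i hi => by simpa using hi
  refine ((h1.image some).insert none).subset fun h hh => ?_
  rcases h with _ | i
  · simp
  · simpa using hh i rfl

theorem exists_min_deficit (S : Multiset X) :
    ∃ h ∈ F.cands S, ∀ h' ∈ F.cands S, F.deficit S h ≤ F.deficit S h' :=
  Set.exists_min_image _ _ (F.finite_cands S) ⟨none, fun _ hi => by simp at hi⟩

/-- The learner which returns a candidate of least deficit. -/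
noncomputable def learner : Learner X := fun S => F.candLaw (F.exists_min_deficit S).choose

/-- The learner succeeds on samples whose empirical frequencies are accurate. -/
theorem tvDist_learner_le (i : I) {q : PMF X} {η t e : ℝ} {S : Multiset X} (hη : 0 ≤ η)
    (hη' : η ≤ 1 / 3) (ht : 0 ≤ t) (he : 0 ≤ e)
    (hq : ∀ E, (1 - η) * prob (F.law i) E ≤ prob q E) (hS : 0 < S.card)
    (hbase : hits {F.base} S ≤ S.card * (prob q {F.base} + t))
    (hbase' : hits {F.base}ᶜ S ≤ S.card * (prob q {F.base}ᶜ + t))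
    (hregion : hits (F.region i)ᶜ S ≤ S.card * (prob q (F.region i)ᶜ + t))
    (hmarked : ∀ j, F.mark j ∈ S → hits (F.region j) S ≤ S.card * (prob q (F.region j) + t))
    (hi : e ≤ F.weight i → F.mark i ∈ S) :
    tvDist (F.learner S) (F.law i) ≤ 3 * η + 3 * (2 * t + e) := by
  have hS' : (0 : ℝ) < S.card := by exact_mod_cast hS
  have hw : 0 ≤ F.weight i := F.prob_region i ▸ prob_nonneg _ _
  have hw1 : F.weight i ≤ 1 := F.prob_region i ▸ prob_le_one _ _
  have hcompl : ∀ E : Set X, hits Eᶜ S ≤ S.card * (prob q Eᶜ + t) →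
      prob q E - t ≤ hits E S / S.card := by
    intro E hE
    have : (hits E S : ℝ) + hits Eᶜ S = S.card := by exact_mod_cast hits_add_hits_compl E S
    rw [prob_compl] at hE
    rw [le_div_iff₀ hS']
    linarith
  have hlow : ∀ E : Set X, hits E S ≤ S.card * (prob q E + t) →
      hits E S / S.card ≤ prob q E + t := by
    intro E hE
    rwa [div_le_iff₀ hS', mul_comm]
  have hb := hcompl _ hbase'
  have hqb := hq {F.base}
  have hqr := hq (F.region i)
  rw [F.prob_base] at hqb
  rw [F.prob_region] at hqr
  obtain ⟨hmem, hmin⟩ := (F.exists_min_deficit S).choose_spec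
  change tvDist (F.candLaw (F.exists_min_deficit S).choose) (F.law i) ≤ _
  set h := (F.exists_min_deficit S).choose
  -- The competitor is the true index if its mark is guaranteed to occur; otherwise its weight is
  -- below `e` and the point mass at the base does as well up to `e`.
  have hdef : F.deficit S h ≤ η + t + e := by
    by_cases hiw : e ≤ F.weight i
    · refine (hmin (some i) fun j hj => ?_).trans ?_
      · cases hj
        exact hi hiw
      · have hr := hcompl _ hregion
        refine max_le ?_ ?_ <;> simp only [candWeight, candRegion] <;> nlinarith
    · refine (hmin none fun j hj => by simp at hj).trans ?_
      have hpos : (0 : ℝ) ≤ hits (∅ : Set X) S / S.card := by positivity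
      refine max_le ?_ ?_ <;> simp only [candWeight, candRegion] <;> nlinarith
  obtain ⟨hd1, hd2⟩ := max_le_iff.1 hdef
  refine F.tvDist_candLaw_le_of_fit i h hη hη' (by positivity) hq ?_ ?_
  · have := hlow _ hbase
    linarith
  · have : (hits (F.candRegion h) S : ℝ) / S.card ≤ prob q (F.candRegion h) + t := by
      rcases hh : h with _ | j
      · simp [candRegion, hits, prob_empty, ht]
      · exact hlow _ (hmarked j (hmem j hh))
    linarith

theorem obliviouslyAdditivelyLearnable :
    ObliviouslyAdditivelyLearnable 3 (Set.range F.law) := by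
  choose c hc hcm using F.exists_le_prob_mark
  have hsample : ∀ ε δ : ℝ, ∃ M : ℕ, 0 < ε → 0 < δ → ∀ m, M ≤ m → ∀ (i : I) (q : PMF X) (η : ℝ),
      0 ≤ η → η ≤ 1 / 3 → (∀ E, (1 - η) * prob (F.law i) E ≤ prob q E) →
      1 - δ ≤ prob (iidSample q m) {S | tvDist (F.learner S) (F.law i) ≤ 3 * η + ε} := by
    intro ε δ
    by_cases hpos : 0 < ε ∧ 0 < δ
    swap
    · exact ⟨0, fun h1 h2 => absurd ⟨h1, h2⟩ hpos⟩
    obtain ⟨hε, hδ⟩ := hpos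
    -- With `t = e = ε / 9` the error term `3 * (2 * t + e)` is exactly `ε`; the five bad events get
    -- `δ / 5` each.
    have he : 0 < ε / 9 := by positivity
    have hδ5 : 0 < δ / 5 := by positivity
    obtain ⟨M₁, hM₁⟩ := exists_prob_hits_le (X := X) he hδ5
    obtain ⟨M₂, hM₂⟩ := exists_prob_exists_hits_le (X := X) he hδ5
    obtain ⟨M₃, hM₃⟩ := exists_prob_hits_le (X := X)
      (show 0 < c (ε / 9) he / 2 from half_pos (hc _ _)) hδ5
    refine ⟨max (max M₁ M₂) (max M₃ 1), fun _ _ m hm i q η hη hη' hq => ?_⟩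
    simp only [max_le_iff] at hm
    obtain ⟨⟨hm₁, hm₂⟩, hm₃, hm0⟩ := hm
    set P := iidSample q m
    -- Attaches to each mark the region of its index, so that the single event `B₄` covers all
    -- candidates marked in the sample.
    let R : X → Set X := Function.extend F.mark F.region fun _ => ∅
    let B₁ : Set (Multiset X) := {S | m * (prob q {F.base} + ε / 9) < hits {F.base} S}
    let B₂ : Set (Multiset X) := {S | m * (prob q {F.base}ᶜ + ε / 9) < hits {F.base}ᶜ S}
    let B₃ : Set (Multiset X) :=
      {S | m * (prob q (F.region i)ᶜ + ε / 9) < hits (F.region i)ᶜ S}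
    let B₄ : Set (Multiset X) := {S | ∃ x ∈ S, m * (prob q (R x) + ε / 9) < hits (R x) S}
    let B₅ : Set (Multiset X) :=
      {S | m * (prob q {F.mark i}ᶜ + c (ε / 9) he / 2) < hits {F.mark i}ᶜ S}
    have hbad : prob P {S | tvDist (F.learner S) (F.law i) ≤ 3 * η + ε}ᶜ ≤
        prob P (P.supportᶜ ∪ (B₁ ∪ (B₂ ∪ (B₃ ∪ (B₄ ∪ B₅))))) := by
      refine prob_mono P fun S hS => ?_
      by_contra hgood
      simp only [Set.mem_union, not_or, B₁, B₂, B₃, B₄, B₅, Set.mem_ofPred_eq, not_lt, not_exists,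
        not_and, Set.mem_compl_iff, not_not] at hgood
      obtain ⟨h0, h1, h2, h3, h4, h5⟩ := hgood
      have hcard := iidSample_card q m S h0
      refine hS ?_
      rw [Set.mem_ofPred_eq]
      have := F.tvDist_learner_le (S := S) (t := ε / 9) (e := ε / 9) i hη hη' he.le he.le hq
        (by omega) (by rwa [hcard]) (by rwa [hcard]) (by rwa [hcard])
        (fun j hj => by
          have := h4 _ hj
          simp only [R, F.mark_injective.extend_apply] at this
          rwa [hcard])
        (fun hw => by
          -- If the mark were missing, its complement would have frequency one, although `q` gives
          -- the mark at least `2 / 3 * c`, more than the tolerance `c / 2`.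
          by_contra hmem
          have hm1 : (1 : ℝ) ≤ m := by exact_mod_cast hm0
          have hhit : hits {F.mark i} S = 0 := by
            classical
            rw [hits, Multiset.countP_eq_zero]
            rintro x hx rfl
            exact hmem hx
          have hcc : hits {F.mark i}ᶜ S = m := by
            have := hits_add_hits_compl {F.mark i} S
            omega
          rw [hcc, prob_compl] at h5
          have hp := hcm _ he i hw
          have hqm := hq {F.mark i}
          have hc0 := hc _ he
          have hqc : 2 / 3 * c (ε / 9) he ≤ prob q {F.mark i} := by nlinarith
          have : 0 < (m : ℝ) * (prob q {F.mark i} - c (ε / 9) he / 2) :=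
            mul_pos (by linarith) (by linarith)
          linarith)
      linarith
    have hsupp : prob P P.supportᶜ = 0 := by
      rw [prob, (PMF.toOuterMeasure_apply_eq_zero_iff P _).2 disjoint_compl_right,
        ENNReal.toReal_zero]
    have h1 := hM₁ m hm₁ q {F.base}
    have h2 := hM₁ m hm₁ q {F.base}ᶜ
    have h3 := hM₁ m hm₁ q (F.region i)ᶜ
    have h4 := hM₂ m hm₂ q R
    have h5 := hM₃ m hm₃ q {F.mark i}ᶜ
    have u0 := prob_union_le P P.supportᶜ (B₁ ∪ (B₂ ∪ (B₃ ∪ (B₄ ∪ B₅))))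
    have u1 := prob_union_le P B₁ (B₂ ∪ (B₃ ∪ (B₄ ∪ B₅)))
    have u2 := prob_union_le P B₂ (B₃ ∪ (B₄ ∪ B₅))
    have u3 := prob_union_le P B₃ (B₄ ∪ B₅)
    have u4 := prob_union_le P B₄ B₅
    rw [prob_compl] at hbad
    linarith
  choose mC hmC using hsample
  refine ⟨F.learner, mC, ?_⟩
  rintro _ ⟨i, rfl⟩ V η ⟨hη0, hη1, hV⟩ ε hε δ hδ m hm
  by_cases hη : η ≤ 1 / 3
  · obtain ⟨r, hr⟩ := hV (F.law i)
    refine hmC ε δ hε.1 hδ.1 m hm i (V (F.law i)) η hη0 hη fun E => ?_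
    refine mul_prob_le (by linarith) fun x _ => ?_
    rw [hr x]
    have : 0 ≤ η * (r x).toReal := mul_nonneg hη0 ENNReal.toReal_nonneg
    linarith
  · have : {S | tvDist (F.learner S) (F.law i) ≤ 3 * η + ε} = Set.univ :=
      Set.eq_univ_of_forall fun S => by
        have := tvDist_le_one (F.learner S) (F.law i)
        rw [Set.mem_ofPred_eq]
        linarith [hε.1]
    rw [this, prob_univ]
    linarith [hδ.1]

end MarkedFamily

/-! ### The separating class -/

/-- A member of the class: a level `j`, a size `n` and a labelling of `{0, …, n}`, given as the
set of points with label `true`. -/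
abbrev Index := ℕ × ℕ × Finset ℕ

/-- The outcome of a latent draw: the base (`none`), the mark (`some none`), or a data point. -/
abbrev Token (n : ℕ) := Option (Option (Fin (n + 1)))

/-- The domain points: the base, the marks, and the labelled data points `(j, n, x, b)`. -/
abbrev Point := Option (Index ⊕ (ℕ × ℕ × ℕ × Bool))

/-- The location of a point in `ℕ × ℕ`. -/
def loc (y : Point) : ℕ × ℕ := (Encodable.encode y, 0)

theorem loc_injective : Function.Injective loc := fun _ _ h =>
  Encodable.encode_injective (congrArg Prod.fst h)

/-- The base point. -/
def basePt : ℕ × ℕ := loc none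

/-- The mark of an index. -/
def markPt (i : Index) : ℕ × ℕ := loc (some (Sum.inl i))

/-- A labelled data point. -/
def dataPt (j n x : ℕ) (b : Bool) : ℕ × ℕ := loc (some (Sum.inr (j, n, x, b)))

/-- The point of the domain at which a token shows up for the labelling `f`. -/
def place (j n : ℕ) (f : Finset ℕ) : Token n → ℕ × ℕ
  | none => basePt
  | some none => markPt (j, n, f)
  | some (some x) => dataPt j n x (decide ((x : ℕ) ∈ f))

theorem place_injective (j n : ℕ) (f : Finset ℕ) : Function.Injective (place j n f) := by
  rintro (_ | _ | x) (_ | _ | y) h <;>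
    simp_all [place, basePt, markPt, dataPt, loc_injective.eq_iff, Fin.ext_iff]

/-- The mass off the base at level `j`. -/
noncomputable def levelWeight (j : ℕ) : ℝ := 1 / (j + 1)

theorem levelWeight_pos (j : ℕ) : 0 < levelWeight j := by unfold levelWeight; positivity

theorem levelWeight_le_one (j : ℕ) : levelWeight j ≤ 1 := by
  unfold levelWeight
  rw [div_le_one (by positivity)]
  linarith [(Nat.cast_nonneg j : (0 : ℝ) ≤ j)]

/-- The masses of the tokens. -/
noncomputable def tokenMass (j n : ℕ) : Token n → ℝ
  | none => 1 - levelWeight j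
  | some none => levelWeight j ^ 2
  | some (some _) => (levelWeight j - levelWeight j ^ 2) / (n + 1)

theorem tokenMass_nonneg (j n : ℕ) : ∀ τ, 0 ≤ tokenMass j n τ
  | none => by linarith [tokenMass.eq_1 j n, levelWeight_le_one j]
  | some none => sq_nonneg _
  | some (some _) => div_nonneg (by nlinarith [levelWeight_le_one j, levelWeight_pos j])
      (by positivity)

/-- The law of a latent draw. -/
noncomputable def tokenLaw (j n : ℕ) : PMF (Token n) :=
  PMF.ofFintype (fun τ => ENNReal.ofReal (tokenMass j n τ)) <| by
    rw [← ENNReal.ofReal_sum_of_nonneg fun τ _ => tokenMass_nonneg j n τ, ← ENNReal.ofReal_one]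
    congr 1
    simp only [Fintype.sum_option, tokenMass, Finset.sum_const, Finset.card_univ,
      Fintype.card_fin, nsmul_eq_mul]
    push_cast
    field_simp
    ring

theorem tokenLaw_toReal (j n : ℕ) (τ : Token n) : (tokenLaw j n τ).toReal = tokenMass j n τ := by
  rw [tokenLaw, PMF.ofFintype_apply, ENNReal.toReal_ofReal (tokenMass_nonneg j n τ)]

theorem prob_tokenLaw_none (j n : ℕ) : prob (tokenLaw j n) {none} = 1 - levelWeight j := by
  rw [prob_singleton, tokenLaw_toReal, tokenMass]

theorem prob_tokenLaw_mark (j n : ℕ) :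
    prob (tokenLaw j n) {some none} = levelWeight j ^ 2 := by
  rw [prob_singleton, tokenLaw_toReal, tokenMass]

/-- The members of the class. -/
noncomputable def member (i : Index) : PMF (ℕ × ℕ) :=
  (tokenLaw i.1 i.2.1).map (place i.1 i.2.1 i.2.2)

/-- The points off the base at which a member lives. -/
def memberRegion (i : Index) : Set (ℕ × ℕ) := place i.1 i.2.1 i.2.2 '' {none}ᶜ

theorem member_place (i : Index) (τ : Token i.2.1) :
    member i (place i.1 i.2.1 i.2.2 τ) = tokenLaw i.1 i.2.1 τ := by
  have := prob_map (tokenLaw i.1 i.2.1) (place i.1 i.2.1 i.2.2) {place i.1 i.2.1 i.2.2 τ}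
  rw [← Set.image_singleton, Set.preimage_image_eq _ (place_injective _ _ _), Set.image_singleton,
    prob_singleton, prob_singleton] at this
  exact (ENNReal.toReal_eq_toReal_iff' (PMF.apply_ne_top _ _) (PMF.apply_ne_top _ _)).1 this

theorem prob_member_mark (i : Index) : prob (member i) {markPt i} = levelWeight i.1 ^ 2 := by
  have : place i.1 i.2.1 i.2.2 ⁻¹' {markPt i} = {some none} := by
    rw [show ({markPt i} : Set (ℕ × ℕ)) = place i.1 i.2.1 i.2.2 '' {some none} by
      rw [Set.image_singleton]; rfl, Set.preimage_image_eq _ (place_injective _ _ _)]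
  rw [member, prob_map, this, prob_tokenLaw_mark]

theorem prob_member_region (i : Index) : prob (member i) (memberRegion i) = levelWeight i.1 := by
  rw [member, prob_map, memberRegion, Set.preimage_image_eq _ (place_injective _ _ _),
    prob_compl, prob_tokenLaw_none]
  ring

/-- A common point off the base is either a mark, which forces equal indices, or a data point, which
records `j` and `n`; its mass depends on these alone and not on the labelling. -/
theorem member_le (i i' : Index) : ∀ x ∈ memberRegion i, x ∈ memberRegion i' →
    member i x ≤ member i' x := by
  obtain ⟨j, n, f⟩ := i
  obtain ⟨j', n', f'⟩ := i'
  rintro _ ⟨τ, hτ, rfl⟩ ⟨τ', hτ', heq⟩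
  have h : ∃ (h : n = n'), j = j' ∧ tokenLaw j n τ = tokenLaw j n (h ▸ τ') := by
    rcases τ with _ | _ | x
    · exact absurd rfl hτ
    · rcases τ' with _ | _ | y
      · exact absurd rfl hτ'
      · simp only [place, markPt, loc_injective.eq_iff, Option.some.injEq, Sum.inl.injEq,
          Prod.mk.injEq] at heq
        obtain ⟨rfl, rfl, rfl⟩ := heq
        exact ⟨rfl, rfl, rfl⟩
      · simp [place, markPt, dataPt, loc_injective.eq_iff] at heq
    · rcases τ' with _ | _ | y
      · exact absurd rfl hτ'
      · simp [place, markPt, dataPt, loc_injective.eq_iff] at heq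
      · simp only [place, dataPt, loc_injective.eq_iff, Option.some.injEq, Sum.inr.injEq,
          Prod.mk.injEq] at heq
        obtain ⟨rfl, rfl, -, -⟩ := heq
        exact ⟨rfl, rfl, rfl⟩
  obtain ⟨rfl, rfl, h⟩ := h
  rw [← heq]
  have h1 := member_place (j, n, f) τ
  have h2 := member_place (j, n, f') τ'
  simp only at h1 h2 heq h
  rw [h2, heq, h1, h]

/-- The separating class as a marked family. -/
noncomputable def separatingFamily : MarkedFamily Index (ℕ × ℕ) where
  base := basePt
  law := member
  weight i := levelWeight i.1
  region := memberRegion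
  mark := markPt
  mark_injective i i' h := by simpa [markPt, loc_injective.eq_iff] using h
  base_notMem := by
    rintro ⟨j, n, f⟩ ⟨τ, hτ, h⟩
    exact hτ (place_injective j n f (a₂ := none) h)
  prob_base i := by
    have : place i.1 i.2.1 i.2.2 ⁻¹' {basePt} = {none} := by
      rw [show ({basePt} : Set (ℕ × ℕ)) = place i.1 i.2.1 i.2.2 '' {none} by
        rw [Set.image_singleton]; rfl, Set.preimage_image_eq _ (place_injective _ _ _)]
    rw [member, prob_map, this, prob_tokenLaw_none]
  prob_region := prob_member_region
  law_le := member_le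
  -- The mass of the mark does not depend on `n`, which makes the sample size uniform over the
  -- class.
  exists_le_prob_mark ε hε := by
    refine ⟨ε ^ 2, by positivity, fun i hi => ?_⟩
    rw [prob_member_mark]
    gcongr

/-! ### The adaptive adversary -/

/-- The data points of size `n` that do not occur in the sample. -/
def unseen (j n : ℕ) (S : Multiset (ℕ × ℕ)) : Finset ℕ :=
  (Finset.range (n + 1)).filter fun x => ∀ b, dataPt j n x b ∉ S

/-- The labelling that agrees with `f` on the sample and disagrees off it. -/
def flipUnseen (j n : ℕ) (f : Finset ℕ) (S : Multiset (ℕ × ℕ)) : Finset ℕ :=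
  symmDiff f (unseen j n S)

/-- The points added to a sample: as many copies of the mark of the flipped labelling as there are
of the mark of `f`, and copies of the base. -/
noncomputable def addedPoints (j n : ℕ) (η : ℝ) (f : Finset ℕ) (S : Multiset (ℕ × ℕ)) :
    Multiset (ℕ × ℕ) :=
  if S.count (markPt (j, n, f)) ≤ ⌊η * S.card⌋₊ then
    Multiset.replicate (S.count (markPt (j, n, f))) (markPt (j, n, flipUnseen j n f S)) +
      Multiset.replicate (⌊η * S.card⌋₊ - S.count (markPt (j, n, f))) basePt
  -- There are too many marks to imitate within the budget; only the prescribed size is kept.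
  else Multiset.replicate ⌊η * S.card⌋₊ basePt

theorem card_addedPoints (j n : ℕ) (η : ℝ) (f : Finset ℕ) (S : Multiset (ℕ × ℕ)) :
    (addedPoints j n η f S).card = ⌊η * S.card⌋₊ := by
  unfold addedPoints
  split_ifs with h
  · simp [h]
  · simp

/-- The adversary that makes `f` indistinguishable from the flipped labelling. -/
noncomputable def maskingAdversary (j n : ℕ) (η : ℝ) (f : Finset ℕ) :
    AdaptiveAdversary (ℕ × ℕ) :=
  fun S => PMF.pure (S + addedPoints j n η f S)

theorem maskingAdversary_isAdditive (j n : ℕ) (η : ℝ) (f : Finset ℕ) :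
    (maskingAdversary j n η f).IsAdditive := by
  intro S T hT
  rw [maskingAdversary, PMF.support_pure, Set.mem_singleton_iff] at hT
  exact hT ▸ Multiset.le_add_right _ _

/-- An adversary that adds exactly `⌊η m⌋` points to samples of size `m` has budget `η`. -/
theorem AdaptiveAdversary.hasBudget_of_card {X : Type*} [Nonempty X] {V : AdaptiveAdversary X}
    {η : ℝ} (h0 : 0 ≤ η) (h1 : η ≤ 1)
    (h : ∀ S, ∀ T ∈ (V S).support, T.card = S.card + ⌊η * S.card⌋₊) : V.HasBudget η := by
  have hb : ∀ m : ℕ, m * V.addBudget m = ⌊η * m⌋₊ := by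
    intro m
    have : {b : ℝ | ∃ S : Multiset X, S.card = m ∧ ∃ T ∈ (V S).support,
        b = ((T.card : ℝ) - (S.card : ℝ)) / (m : ℝ)} = {(⌊η * m⌋₊ : ℝ) / m} := by
      ext b
      simp only [Set.mem_ofPred_eq, Set.mem_singleton_iff]
      constructor
      · rintro ⟨S, rfl, T, hT, rfl⟩
        rw [h S T hT]
        push_cast
        ring
      · rintro rfl
        obtain ⟨x⟩ := ‹Nonempty X›
        obtain ⟨T, hT⟩ := (V (Multiset.replicate m x)).support_nonempty
        refine ⟨_, Multiset.card_replicate m x, T, hT, ?_⟩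
        rw [h _ T hT, Multiset.card_replicate]
        push_cast
        ring
    rw [addBudget, this, csSup_singleton]
    -- At `m = 0` the budget is a quotient by zero, and the factor `m` and the floor both vanish.
    rcases Nat.eq_zero_or_pos m with rfl | hm
    · simp
    · field_simp
  refine ⟨h0, h1, fun S₁ S₂ hS T₁ hT₁ T₂ hT₂ => ?_, fun m => ?_, fun m => ?_⟩
  · rw [h S₁ T₁ hT₁, h S₂ T₂ hT₂, hS]
  · rw [hb]
    linarith [Nat.lt_floor_add_one (η * m)]
  · rw [hb]
    exact Nat.floor_le (by positivity)

theorem maskingAdversary_hasBudget (j n : ℕ) {η : ℝ} (h0 : 0 ≤ η) (h1 : η ≤ 1) (f : Finset ℕ) :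
    (maskingAdversary j n η f).HasBudget η := by
  refine AdaptiveAdversary.hasBudget_of_card h0 h1 fun S T hT => ?_
  rw [maskingAdversary, PMF.support_pure, Set.mem_singleton_iff] at hT
  rw [hT, Multiset.card_add, card_addedPoints]

/-! ### Indistinguishable labellings and the averaging argument. -/

/-- The data points that do not occur among the tokens. -/
def unseenToken {n : ℕ} (L : Multiset (Token n)) : Finset ℕ :=
  (Finset.range (n + 1)).filter fun y => ∀ x : Fin (n + 1), some (some x) ∈ L → (x : ℕ) ≠ y

/-- The unseen set depends on the tokens only, so for fixed tokens flipping is an involution on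
labellings. -/
theorem unseen_map_place (j n : ℕ) (f : Finset ℕ) (L : Multiset (Token n)) :
    unseen j n (L.map (place j n f)) = unseenToken L := by
  refine Finset.filter_congr fun y _ => ?_
  constructor
  · rintro h x hx rfl
    exact h _ (Multiset.mem_map.2 ⟨_, hx, rfl⟩)
  · intro h b hb
    obtain ⟨_ | _ | x, hx, heq⟩ := Multiset.mem_map.1 hb
    · simp [place, basePt, dataPt, loc_injective.eq_iff] at heq
    · simp [place, markPt, dataPt, loc_injective.eq_iff] at heq
    · simp only [place, dataPt, loc_injective.eq_iff, Option.some.injEq, Sum.inr.injEq,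
        Prod.mk.injEq] at heq
      exact h x hx heq.2.2.1

theorem mem_unseenToken {n : ℕ} {L : Multiset (Token n)} {x : Fin (n + 1)} :
    (x : ℕ) ∈ unseenToken L ↔ some (some x) ∉ L := by
  simp only [unseenToken, Finset.mem_filter, Finset.mem_range]
  constructor
  · rintro ⟨-, h⟩ hx
    exact h x hx rfl
  · intro h
    refine ⟨x.2, fun y hy heq => h ?_⟩
    rwa [← Fin.ext heq]

theorem mem_symmDiff_unseenToken {n : ℕ} {L : Multiset (Token n)} {f : Finset ℕ}
    {x : Fin (n + 1)} :
    ((x : ℕ) ∈ f ↔ (x : ℕ) ∈ symmDiff f (unseenToken L)) ↔ some (some x) ∈ L := by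
  rw [Finset.mem_symmDiff, mem_unseenToken]
  tauto

/-- Seen data points carry the same label under `f` and `g`, and each mark token gives one mark of
either labelling on both sides. -/
theorem map_place_add_replicate (j n : ℕ) (f g : Finset ℕ) (L : Multiset (Token n))
    (h : ∀ x : Fin (n + 1), some (some x) ∈ L → ((x : ℕ) ∈ f ↔ (x : ℕ) ∈ g)) :
    L.map (place j n f) + Multiset.replicate (L.count (some none)) (markPt (j, n, g)) =
      L.map (place j n g) + Multiset.replicate (L.count (some none)) (markPt (j, n, f)) := by
  induction L using Multiset.induction_on with
  | empty => simp
  | cons τ L ih =>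
    have ih := ih fun x hx => h x (Multiset.mem_cons_of_mem hx)
    rw [Multiset.map_cons, Multiset.map_cons, Multiset.cons_add, Multiset.cons_add]
    rcases τ with _ | _ | x
    · rw [Multiset.count_cons_of_ne (by simp), ih]
      rfl
    · rw [Multiset.count_cons_self, Multiset.replicate_succ, Multiset.replicate_succ,
        Multiset.add_cons, Multiset.add_cons, ih, Multiset.cons_swap]
      rfl
    · rw [Multiset.count_cons_of_ne (by simp), ih]
      congr 1
      simp only [place, h x (Multiset.mem_cons_self _ _)]

/-- The manipulated sample coming from the tokens `L` and the labelling `f`. -/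
noncomputable def maskedSample (j n : ℕ) (η : ℝ) (L : Multiset (Token n)) (f : Finset ℕ) :
    Multiset (ℕ × ℕ) :=
  L.map (place j n f) + addedPoints j n η f (L.map (place j n f))

theorem maskedSample_eq {j n : ℕ} {η : ℝ} {L : Multiset (Token n)} (f : Finset ℕ)
    (h : L.count (some none) ≤ ⌊η * L.card⌋₊) :
    maskedSample j n η L f = L.map (place j n f) +
      Multiset.replicate (L.count (some none)) (markPt (j, n, symmDiff f (unseenToken L))) +
        Multiset.replicate (⌊η * L.card⌋₊ - L.count (some none)) basePt := by
  have hc : (L.map (place j n f)).count (markPt (j, n, f)) = L.count (some none) :=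
    Multiset.count_map_eq_count' _ _ (place_injective j n f) (some none)
  rw [maskedSample, addedPoints, hc, Multiset.card_map, if_pos h, flipUnseen, unseen_map_place,
    add_assoc]

/-- The heart of the lower bound: `f` and its flip exchange the roles of true and added marks, so
the learner receives the same input. -/
theorem maskedSample_symmDiff {j n : ℕ} {η : ℝ} {L : Multiset (Token n)} (f : Finset ℕ)
    (h : L.count (some none) ≤ ⌊η * L.card⌋₊) :
    maskedSample j n η L (symmDiff f (unseenToken L)) = maskedSample j n η L f := by
  rw [maskedSample_eq _ h, maskedSample_eq _ h, symmDiff_symmDiff_cancel_right,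
    map_place_add_replicate j n f _ L fun x hx => mem_symmDiff_unseenToken.2 hx]

/-- The flipped labelling belongs to a distribution far from that of the labelling. -/
theorem half_levelWeight_le {j n : ℕ} (f : Finset ℕ) {L : Multiset (Token n)}
    (hL : 2 * L.card ≤ n) :
    levelWeight j / 2 ≤ tvDist (member (j, n, f)) (member (j, n, symmDiff f (unseenToken L))) := by
  set g := symmDiff f (unseenToken L) with hg
  let seen : Finset (Token n) := L.toFinset.filter fun τ => ∃ x, τ = some (some x)
  have hcard : seen.card ≤ L.card := (Finset.card_filter_le _ _).trans L.toFinset_card_le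
  -- Needed to make the marks distinct; the sample is too small to contain all `n + 1` data points.
  have hfg : f ≠ g := by
    intro h
    have hall : ∀ x : Fin (n + 1), some (some x) ∈ L := fun x =>
      mem_symmDiff_unseenToken.1 (by rw [← hg, ← h] : (x : ℕ) ∈ f ↔ _)
    have h1 : (Finset.univ.image fun x : Fin (n + 1) => (some (some x) : Token n)) ⊆
        L.toFinset := by
      intro τ hτ
      obtain ⟨x, -, rfl⟩ := Finset.mem_image.1 hτ
      exact Multiset.mem_toFinset.2 (hall x)
    have h2 := (Finset.card_le_card h1).trans L.toFinset_card_le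
    rw [Finset.card_image_of_injective _ fun x y h => by simpa using h, Finset.card_univ,
      Fintype.card_fin] at h2
    omega
  -- Off the base the two members share only seen data points, at most half of all `n + 1`.
  have hsub : place j n g ⁻¹' memberRegion (j, n, f) ⊆ (seen : Set (Token n)) := by
    rintro τ ⟨τ', hτ', heq⟩
    simp only at heq hτ'
    rcases τ with _ | _ | x <;> rcases τ' with _ | _ | y <;>
      simp only [place, markPt, dataPt, basePt, loc_injective.eq_iff, Option.some.injEq,
        Sum.inr.injEq, Sum.inl.injEq, Prod.mk.injEq, reduceCtorEq, true_and] at heq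
    · exact absurd rfl hτ'
    · exact absurd heq hfg
    · obtain ⟨hxy, hlab⟩ := heq
      obtain rfl := Fin.ext hxy
      refine Finset.mem_coe.2 (Finset.mem_filter.2 ⟨Multiset.mem_toFinset.2 ?_, y, rfl⟩)
      exact mem_symmDiff_unseenToken.1 (decide_eq_decide.1 hlab)
  have hsmall : prob (member (j, n, g)) (memberRegion (j, n, f)) ≤ levelWeight j / 2 := by
    rw [member, prob_map]
    refine (prob_mono _ hsub).trans ?_
    rw [prob, PMF.toOuterMeasure_apply_finset, ENNReal.toReal_sum fun τ _ => PMF.apply_ne_top _ τ]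
    have hmass : ∀ τ ∈ seen, ((tokenLaw j n) τ).toReal ≤ levelWeight j / (n + 1) := by
      intro τ hτ
      obtain ⟨x, rfl⟩ := (Finset.mem_filter.1 hτ).2
      rw [tokenLaw_toReal, tokenMass]
      gcongr
      linarith [sq_nonneg (levelWeight j)]
    refine (Finset.sum_le_card_nsmul _ _ _ hmass).trans ?_
    have h1 : (2 * seen.card : ℝ) ≤ n + 1 := by exact_mod_cast (by omega : 2 * seen.card ≤ n + 1)
    rw [nsmul_eq_mul, mul_div_assoc', div_le_div_iff₀ (by positivity) two_pos]
    nlinarith [levelWeight_pos j]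
  have h := (le_abs_self _).trans
    (abs_prob_sub_le_tvDist (member (j, n, f)) (member (j, n, g)) (memberRegion (j, n, f)))
  rw [prob_member_region] at h
  simp only at h
  linarith

theorem tvDist_triangle {Ω : Type*} (p q r : PMF Ω) : tvDist p r ≤ tvDist p q + tvDist q r :=
  tvDist_le fun B => by
    have h1 := (le_abs_self _).trans (abs_prob_sub_le_tvDist p q B)
    have h2 := (le_abs_self _).trans (abs_prob_sub_le_tvDist q r B)
    linarith

open Classical in
/-- For given tokens, a learner is accurate for at most half of the labellings. -/
theorem two_mul_card_accurate_le {j n : ℕ} {η c : ℝ} (A : Learner (ℕ × ℕ))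
    {L : Multiset (Token n)} (hL : 2 * L.card ≤ n) (h : L.count (some none) ≤ ⌊η * L.card⌋₊)
    (hc : c < levelWeight j / 4) :
    2 * ((Finset.range (n + 1)).powerset.filter fun f =>
      tvDist (A (maskedSample j n η L f)) (member (j, n, f)) ≤ c).card ≤
        (Finset.range (n + 1)).powerset.card := by
  set G := (Finset.range (n + 1)).powerset.filter fun f =>
    tvDist (A (maskedSample j n η L f)) (member (j, n, f)) ≤ c with hG
  have hU : unseenToken L ⊆ Finset.range (n + 1) := Finset.filter_subset _ _
  have hinj : Function.Injective fun f : Finset ℕ => symmDiff f (unseenToken L) :=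
    symmDiff_left_injective _
  -- Were a labelling and its flip both accurate, the common output would put their members within
  -- `2 * c < levelWeight j / 2` of each other.
  have hdisj : Disjoint G (G.image fun f => symmDiff f (unseenToken L)) := by
    refine Finset.disjoint_left.2 fun g hg hg' => ?_
    obtain ⟨f, hf, rfl⟩ := Finset.mem_image.1 hg'
    have h1 := (Finset.mem_filter.1 hf).2
    have h2 := (Finset.mem_filter.1 hg).2
    rw [maskedSample_symmDiff f h] at h2
    rw [tvDist_comm] at h1
    have h3 := tvDist_triangle (member (j, n, f)) (A (maskedSample j n η L f))
      (member (j, n, symmDiff f (unseenToken L)))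
    have h4 := half_levelWeight_le (j := j) f hL
    linarith
  have hsub : G ∪ (G.image fun f => symmDiff f (unseenToken L)) ⊆
      (Finset.range (n + 1)).powerset := by
    refine Finset.union_subset (Finset.filter_subset _ _) fun g hg => ?_
    obtain ⟨f, hf, rfl⟩ := Finset.mem_image.1 hg
    have := Finset.mem_powerset.1 (Finset.mem_filter.1 hf).1
    exact Finset.mem_powerset.2 (symmDiff_le_sup.trans (Finset.union_subset this hU))
  have := Finset.card_le_card hsub
  rw [Finset.card_union_of_disjoint hdisj, Finset.card_image_of_injective _ hinj] at this
  omega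

/-- The law of the manipulated sample in terms of the tokens. -/
theorem toOuterMeasure_masked (j n m : ℕ) (η : ℝ) (f : Finset ℕ) (E : Set (Multiset (ℕ × ℕ))) :
    ((iidSample (member (j, n, f)) m).bind (maskingAdversary j n η f)).toOuterMeasure E =
      expect (iidSample (tokenLaw j n) m) fun L => E.indicator 1 (maskedSample j n η L f) := by
  rw [toOuterMeasure_eq_expect, expect_bind, member, iidSample_map, expect_map]
  simp only [maskingAdversary, expect_pure, maskedSample]

/-- Averaged over the labellings, a learner is accurate with probability little above `1 / 2`. -/
theorem sum_prob_accurate_le {j n m : ℕ} {η c d : ℝ} (A : Learner (ℕ × ℕ)) (hm : 2 * m ≤ n)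
    (hc : c < levelWeight j / 4)
    (hd : prob (iidSample (tokenLaw j n) m) {L | ⌊η * m⌋₊ < L.count (some none)} ≤ d) :
    ∑ f ∈ (Finset.range (n + 1)).powerset,
      prob ((iidSample (member (j, n, f)) m).bind (maskingAdversary j n η f))
        {T | tvDist (A T) (member (j, n, f)) ≤ c} ≤
      (Finset.range (n + 1)).powerset.card * (1 / 2 + d) := by
  classical
  set P := (Finset.range (n + 1)).powerset
  set μ := iidSample (tokenLaw j n) m
  set B : Set (Multiset (Token n)) := {L | ⌊η * m⌋₊ < L.count (some none)}
  have hd0 : 0 ≤ d := (prob_nonneg _ _).trans hd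
  have hpt : ∀ L ∈ μ.support, (∑ f ∈ P,
      ({T | tvDist (A T) (member (j, n, f)) ≤ c} : Set (Multiset (ℕ × ℕ))).indicator
        (1 : Multiset (ℕ × ℕ) → ℝ≥0∞) (maskedSample j n η L f)) ≤
      ENNReal.ofReal (P.card / 2) + P.card * B.indicator 1 L := by
    intro L hL
    have hcard := iidSample_card _ m L hL
    have hsum : (∑ f ∈ P,
        ({T | tvDist (A T) (member (j, n, f)) ≤ c} : Set (Multiset (ℕ × ℕ))).indicator
          (1 : Multiset (ℕ × ℕ) → ℝ≥0∞) (maskedSample j n η L f)) = ((P.filter fun f =>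
            tvDist (A (maskedSample j n η L f)) (member (j, n, f)) ≤ c).card : ℝ≥0∞) := by
      rw [Finset.card_filter]
      push_cast
      refine Finset.sum_congr rfl fun f _ => ?_
      simp [Set.indicator_apply]
    rw [hsum]
    by_cases hB : L ∈ B
    · rw [Set.indicator_of_mem hB, Pi.one_apply, mul_one]
      exact le_add_left (by exact_mod_cast Finset.card_filter_le _ _)
    · refine le_add_right ?_
      have h2 := two_mul_card_accurate_le (η := η) (c := c) A (L := L) (by omega)
        (by rw [hcard]; exact not_lt.1 hB) hc
      rw [← ENNReal.ofReal_natCast]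
      refine ENNReal.ofReal_le_ofReal ?_
      rw [le_div_iff₀ two_pos]
      exact_mod_cast (mul_comm _ _).trans_le h2
  have key : (∑ f ∈ P,
      ((iidSample (member (j, n, f)) m).bind (maskingAdversary j n η f)).toOuterMeasure
        {T | tvDist (A T) (member (j, n, f)) ≤ c}) ≤ ENNReal.ofReal (P.card * (1 / 2 + d)) := by
    simp only [toOuterMeasure_masked]
    -- The token law is the same for all labellings, so averaging over `f` can be done for fixed
    -- tokens.
    rw [← expect_finset_sum]
    calc _ ≤ expect μ fun L => ENNReal.ofReal (P.card / 2) + P.card * B.indicator 1 L := by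
          refine ENNReal.tsum_le_tsum fun L => ?_
          by_cases hL : L ∈ μ.support
          · gcongr
            exact hpt L hL
          · rw [PMF.mem_support_iff, not_not] at hL
            simp only [μ] at hL
            simp [hL]
      _ = ENNReal.ofReal (P.card / 2) + P.card * ENNReal.ofReal (prob μ B) := by
          rw [expect_add, expect_const, expect_const_mul, ofReal_prob, toOuterMeasure_eq_expect]
      _ ≤ ENNReal.ofReal (P.card / 2) + P.card * ENNReal.ofReal d := by gcongr
      _ = _ := by
          rw [← ENNReal.ofReal_natCast, ← ENNReal.ofReal_mul (by positivity),
            ← ENNReal.ofReal_add (by positivity) (by positivity)]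
          congr 1
          ring
  have := ENNReal.toReal_mono ENNReal.ofReal_ne_top key
  rwa [ENNReal.toReal_ofReal (by positivity), ENNReal.toReal_sum fun f _ =>
    toOuterMeasure_ne_top _ _] at this

theorem not_adaptivelyAdditivelyLearnable {α : ℝ} (hα : 1 ≤ α) :
    ¬ AdaptivelyAdditivelyLearnable α (Set.range member) := by
  rintro ⟨A, mC, h⟩
  -- This gives `16 * α * w ≤ 1`, so the allowed error `α * (2 * w ^ 2) + w / 16` is at most `3 * w
  -- / 16 < w / 4`. The budget `2 * w ^ 2` is twice the mass of the mark, which leaves room for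
  -- fluctuations.
  obtain ⟨j, hj⟩ := exists_nat_ge (16 * α)
  set w := levelWeight j with hw
  have hw0 : 0 < w := levelWeight_pos j
  have hwα : 16 * (α * w) ≤ 1 := by
    have : w * (j + 1) = 1 := by rw [hw, levelWeight]; field_simp
    nlinarith
  have hw1 : 16 * w ≤ 1 := by nlinarith
  have hη0 : 0 ≤ 2 * w ^ 2 := by positivity
  have hη1 : 2 * w ^ 2 ≤ 1 := by nlinarith
  have hc : α * (2 * w ^ 2) + w / 16 < w / 4 := by nlinarith
  obtain ⟨M, hM⟩ := exists_prob_hits_le (X := ℕ × ℕ) (show 0 < w ^ 2 by positivity)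
    (show (0 : ℝ) < 1 / 8 by norm_num)
  -- The size `n = 2 * m` is chosen after the learner's sample bound, which may not depend on it.
  set m := max M (mC (w / 16) (1 / 4))
  have hmarks : prob (iidSample (tokenLaw j (2 * m)) m)
      {L | ⌊2 * w ^ 2 * m⌋₊ < L.count (some none)} ≤ 1 / 8 := by
    -- The number of mark tokens does not involve the labelling; the empty one serves to transfer
    -- the bound.
    have h1 := hM m (le_max_left _ _) (member (j, 2 * m, ∅)) {markPt (j, 2 * m, ∅)}
    rw [prob_member_mark, member, iidSample_map, prob_map] at h1
    refine (prob_mono _ fun L hL => ?_).trans h1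
    have h2 : hits {markPt (j, 2 * m, ∅)} (L.map (place j (2 * m) ∅)) = L.count (some none) := by
      classical
      rw [← Multiset.count_map_eq_count' _ L (place_injective j (2 * m) ∅) (some none), hits,
        Multiset.count]
      congr! 1
      exact eq_comm
    have h3 := Nat.lt_of_floor_lt hL
    rw [Set.mem_preimage, Set.mem_ofPred_eq, h2]
    linarith
  have hsum := sum_prob_accurate_le (η := 2 * w ^ 2) A le_rfl hc hmarks
  have hlow : ∀ f ∈ (Finset.range (2 * m + 1)).powerset, (3 / 4 : ℝ) ≤
      prob ((iidSample (member (j, 2 * m, f)) m).bind (maskingAdversary j (2 * m) (2 * w ^ 2) f))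
        {T | tvDist (A T) (member (j, 2 * m, f)) ≤ α * (2 * w ^ 2) + w / 16} := by
    intro f _
    have := h _ ⟨(j, 2 * m, f), rfl⟩ _ _ (maskingAdversary_isAdditive j (2 * m) (2 * w ^ 2) f)
      (maskingAdversary_hasBudget j (2 * m) hη0 hη1 f) (w / 16) ⟨by positivity, by linarith⟩
      (1 / 4) ⟨by norm_num, by norm_num⟩ m (le_max_right _ _)
    linarith
  -- Success `3 / 4` for every labelling contradicts the average bound `1 / 2 + 1 / 8`.
  have hge := Finset.card_nsmul_le_sum _ _ _ hlow
  have hpos : (0 : ℝ) < ((Finset.range (2 * m + 1)).powerset.card : ℝ) := by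
    exact_mod_cast Finset.card_pos.2 ⟨∅, Finset.empty_mem_powerset _⟩
  rw [nsmul_eq_mul] at hge
  linarith

end RobustLearning

theorem mainTheorem8 :
    ∃ C : Set (PMF (ℕ × ℕ)),
      RobustLearning.ObliviouslyAdditivelyLearnable 3 C ∧
        ∀ α : ℝ, 1 ≤ α → ¬ RobustLearning.AdaptivelyAdditivelyLearnable α C :=
  ⟨Set.range RobustLearning.member,
    RobustLearning.separatingFamily.obliviouslyAdditivelyLearnable,
    fun _ hα => RobustLearning.not_adaptivelyAdditivelyLearnable hα⟩
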